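/- Let $R$ be a commutative Hausdorff topological ring (for instance $\mathbb R$, $\mathbb C$, or a ring of formal power series), let $\alpha,\beta\in R$ be invertible, and put $\bar\alpha=1/\alpha$, $\bar\beta=1/\beta$, $c=\bar\alpha-1$, $d=\bar\beta-1$, so that $1-cd=\bar\alpha+\bar\beta-\bar\alpha\bar\beta$. Let $D,E$ be linear operators on an $R$-module, $V$ a vector of it and $W$ a linear functional on it which represent the DEHP algebra of the two-parameter ASEP: $$D+E=DE,\qquad WE=\bar\alpha\,W,\qquad DV=\bar\beta\,V,\qquad WV=1 .$$ For $L\ge 0$ let $Z_L=W(DE)^LV$ be the normalisation. A lattice path of length $2L$ is a sequence of vertices $v_0,\dots,v_{2L}$ with $v_i=(i,h_i)$, $h_i\in\mathbb Z_{\ge0}$; its $i$-th step is $(v_{i-1},v_i)$, of height change $h_i-h_{i-1}$. The weight of a path is the product of the weights of its initial vertex, its final vertex and its steps; weights not listed below are $1$. * $R_1(L)$ (jump paths): $h_0=2k+1$ for some $k\ge0$, $h_{2L}=1$; every even step has height change $-1$, every odd step has height change $2k'-1$ for some $k'\ge0$. The initial vertex has weight $\bar\alpha^{k}$, and each odd step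 from height $1$ to a height $2k'+2$, $k'\ge0$, has weight $\bar\beta$. The total weight is $W^{(1)}$. * $R_2(L)$ (rigged ballot paths): $h_0=2k+1$ and $h_{2L}=2k'+1$ for some $k,k'\ge0$; every step has height change $\pm1$. The initial vertex has weight $\kappa c^{k}$, the final vertex $\kappa d^{k'}$. The total weight is $W^{(2)}$. * $R_3(L)$ (Dyck-type paths): $h_0=h_{2L}=1$; every step has height change $\pm1$. Steps from height $1$ to $2$ and from $2$ to $1$ have weight $\kappa$, steps from $1$ to $0$ have weight $\bar\beta$, steps from $0$ to $1$ have weight $\bar\alpha$. The total weight is $W^{(3)}$. * $R_4(L)$ (canonical, or one-transit, paths): $h_0=h_{2L}=1$; every step has height change $\pm1$; all heights are positive; and one vertex $v_k$ of height $1$ is marked. A step $i\le k$ from height $2$ to $1$ has weight $\bar\alpha$, a step $i>k$ from height $1$ to $2$ has weight $\bar\beta$. The total weight is $W^{(4)}$. Then for every $L\ge0$ the sets $R_1(L)$, $R_3(L)$, $R_4(L)$ are finite and $$Z_L=\sum_{p\in R_1(L)}W^{(1)}(p),\qquad Z_L=\sum_{p\in R_2(L)}W^{(2)}(p),\qquad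 Z_L=\sum_{p\in R_3(L)}W^{(3)}(p),\qquad Z_L=\sum_{p\in R_4(L)}W^{(4)}(p).$$ In the second and third formulas $\kappa$ is any element of $R$ with $\kappa^2=1-cd$. The second formula, an infinite sum, holds (as an unconditionally convergent sum) whenever the geometric series $\sum_{n\ge0}(cd)^n$ converges unconditionally: for real or complex parameters this means $|cd|<1$, and for formal power series in the variables $c$ and $d$ it is automatic. -/

import Mathlib

namespace ASEP

section Algebra

variable {R : Type*} [CommRing R] {M : Type*} [AddCommGroup M] [Module R M]

/-- `D`, `E`, `W`, `V` represent the DEHP algebra of the two-parameter ASEP with parameters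
`α`, `β`: `D + E = D E`, `W E = α⁻¹ W`, `D V = β⁻¹ V`, with the usual normalisation `W V = 1`.
Here `D`, `E` act on a module of column vectors containing `V`, and the row vector `W` is a
linear functional on that module. -/
structure IsDEHP (α β : Rˣ) (D E : Module.End R M) (W : M →ₗ[R] R) (V : M) : Prop where
  add_eq_mul : D + E = D * E
  left_eigenvector : W ∘ₗ E = ((α⁻¹ : Rˣ) : R) • W
  right_eigenvector : D V = ((β⁻¹ : Rˣ) : R) • V
  normalised : W V = 1

/-- The normalisation `Z_L = W (D E)^L V`. -/
def normalisation (D E : Module.End R M) (W : M →ₗ[R] R) (V : M) (L : ℕ) : R :=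
  W (((D * E) ^ L) V)

end Algebra

section RepresentationI

variable {R : Type*} [CommRing R]

/-- The matrix `D` of the first representation: its `n`-th column is `(β⁻¹, 1, …, 1, 0, 0, …)`,
with `n` ones. -/
noncomputable def D₁ (β : Rˣ) : Module.End R (ℕ →₀ R) :=
  Finsupp.linearCombination R fun n : ℕ =>
    Finsupp.single 0 ((β⁻¹ : Rˣ) : R) + ∑ m ∈ Finset.Icc 1 n, Finsupp.single m (1 : R)

/-- The matrix `E` of the first representation: the shift `e_n ↦ e_{n+1}`. -/
noncomputable def E₁ : Module.End R (ℕ →₀ R) :=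
  Finsupp.linearCombination R fun n : ℕ => Finsupp.single (n + 1) (1 : R)

/-- The row vector `W = (1, α⁻¹, α⁻², …)` of the first representation. -/
noncomputable def W₁ (α : Rˣ) : (ℕ →₀ R) →ₗ[R] R :=
  Finsupp.linearCombination R fun n : ℕ => ((α⁻¹ : Rˣ) : R) ^ n

/-- The column vector `V = (1, 0, 0, …)` of the first representation. -/
noncomputable def V₁ : ℕ →₀ R := Finsupp.single 0 1

/-- The DEHP algebra has a representation for all parameters. -/
theorem isDEHP_I (α β : Rˣ) : IsDEHP α β (D₁ β) E₁ (W₁ α) V₁ where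
  add_eq_mul := by
    refine Finsupp.lhom_ext' fun n => LinearMap.ext_ring ?_
    simp [D₁, E₁, Finset.sum_Icc_succ_top, add_assoc]
  left_eigenvector := by
    refine Finsupp.lhom_ext' fun n => LinearMap.ext_ring ?_
    simp [W₁, E₁, pow_succ']
  right_eigenvector := by
    simp [D₁, V₁]
  normalised := by
    simp [W₁, V₁]

end RepresentationI

section Paths

/-- `p : Fin (t + 1) → ℕ` is the lattice path of length `t` with vertices `(i, p i)`, `0 ≤ i ≤ t`,
in `ℤ × ℕ`.  `HasSteps S p` says that for each `i = 1, …, t` the `i`-th step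
`(i - 1, p (i - 1)) → (i, p i)` is of the form `(1, s)` with `s ∈ S i`. -/
def HasSteps (S : ℕ → Set ℤ) {t : ℕ} (p : Fin (t + 1) → ℕ) : Prop :=
  ∀ j : Fin t, (p j.succ : ℤ) - (p j.castSucc : ℤ) ∈ S (j.val + 1)

/-- Every even step goes down by one; an odd step changes the height by `2 k - 1`, `k ≥ 0`. -/
def jumpSteps (i : ℕ) : Set ℤ :=
  if Even i then {-1} else {s | ∃ k : ℕ, s = 2 * (k : ℤ) - 1}

/-- Every step goes up by one or down by one. -/
def dyckSteps (_ : ℕ) : Set ℤ := {-1, 1}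

/-- The jump paths of length `2 L`: they start at an odd height and end at height one. -/
def R₁ (L : ℕ) : Set (Fin (2 * L + 1) → ℕ) :=
  {p | HasSteps jumpSteps p ∧ (∃ k, p 0 = 2 * k + 1) ∧ p (Fin.last (2 * L)) = 1}

/-- The rigged ballot paths of length `2 L`: they start and end at odd heights. -/
def R₂ (L : ℕ) : Set (Fin (2 * L + 1) → ℕ) :=
  {p | HasSteps dyckSteps p ∧ (∃ k, p 0 = 2 * k + 1) ∧ ∃ k', p (Fin.last (2 * L)) = 2 * k' + 1}

/-- The Dyck-type paths of length `2 L` from height one to height one, with heights `≥ 0`. -/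
def R₃ (L : ℕ) : Set (Fin (2 * L + 1) → ℕ) :=
  {p | HasSteps dyckSteps p ∧ p 0 = 1 ∧ p (Fin.last (2 * L)) = 1}

/-- The canonical (one-transit) paths of length `2 L`: pairs `(p, k)` of a path `p` from height one
to height one with all heights positive, and the position `k` of a marked vertex of height one. -/
def R₄ (L : ℕ) : Set ((Fin (2 * L + 1) → ℕ) × Fin (2 * L + 1)) :=
  {q | HasSteps dyckSteps q.1 ∧ q.1 0 = 1 ∧ q.1 (Fin.last (2 * L)) = 1 ∧
    (∀ i, 0 < q.1 i) ∧ q.1 q.2 = 1}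

variable {R : Type*} [CommRing R]

/-- The product over `i = 1, …, t` of the weights `w i x y` of the steps
`(i - 1, x) → (i, y)` of the path `p`. -/
def stepProd (w : ℕ → ℕ → ℕ → R) {t : ℕ} (p : Fin (t + 1) → ℕ) : R :=
  ∏ j : Fin t, w (j.val + 1) (p j.castSucc) (p j.succ)

/-- Weight of a jump path, `a` and `b` standing for `α⁻¹` and `β⁻¹`: a start at height `2 k + 1`
has weight `a ^ k` (and `(2 k + 1) / 2 = k`); an odd step from height one to a height `2 k' + 2`
has weight `b`. -/
def weight₁ (a b : R) {t : ℕ} (p : Fin (t + 1) → ℕ) : R :=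
  a ^ (p 0 / 2) *
    stepProd (fun i x y => if Odd i ∧ x = 1 ∧ 2 ≤ y ∧ Even y then b else 1) p

/-- Weight of a rigged ballot path: `κ c ^ k` for the start at height `2 k + 1` and `κ d ^ k'`
for the end at height `2 k' + 1`. -/
def weight₂ (κ c d : R) {t : ℕ} (p : Fin (t + 1) → ℕ) : R :=
  (κ * c ^ (p 0 / 2)) * (κ * d ^ (p (Fin.last t) / 2))

/-- Weight of a Dyck-type path: `κ` for each step between heights one and two, `b` for each step
from one to zero, `a` for each step from zero to one. -/
def weight₃ (a b κ : R) {t : ℕ} (p : Fin (t + 1) → ℕ) : R :=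
  stepProd (fun _ x y =>
    if (x = 1 ∧ y = 2) ∨ (x = 2 ∧ y = 1) then κ
    else if x = 1 ∧ y = 0 then b
    else if x = 0 ∧ y = 1 then a
    else 1) p

/-- Weight of a canonical path with marked vertex `k`: `a` for each step `i ≤ k` from height two to
one, `b` for each step `i > k` from height one to two. -/
def weight₄ (a b : R) {t : ℕ} (q : (Fin (t + 1) → ℕ) × Fin (t + 1)) : R :=
  stepProd (fun i x y =>
    if x = 2 ∧ y = 1 ∧ i ≤ q.2.val then a
    else if x = 1 ∧ y = 2 ∧ q.2.val < i then b
    else 1) q.1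

end Paths

end ASEP

/-! Each path sum expands the alternating word `D E D E ⋯` between `W` and `V`: odd steps belong to
`D`, even steps to `E`, and removing the last step of a path removes the rightmost factor.

For three families the heights label vectors on which `D` and `E` act by the one-step rule. For jump
paths these are the `E ^ k V` (`transfer_jump`). For Dyck-type paths they are `V` and `(E - 1) ^ k
(E V - α⁻¹ V)` (`transfer_dyckWeight`). For rigged ballot paths `(E - 1) ^ i (D - 1) ^ m V` stands
for a function of the final height (`hasSum_oddStartPaths`). The last two rest on `(D - 1) (E - 1) =
1`. Applying `W` to these vectors gives the case of length zero; the only infinite summation occurs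
there, as a geometric series.

Canonical paths need a different argument. A positive path with `n` returns to height one has `n +
1` vertices of height one, and the choice of mark gives `∑ a ^ i b ^ (n - i)` (`finsum_R₄`). Write
`h_n` for the sum of the ordered monomials `E ^ i D ^ (n - i)`. Then `h_n D E = h_1 + ⋯ + h_{n+1}`
(`homSum_mul`), and the numbers of returns follow the same rule when a path grows by two steps
(`returnSum_add_two`). -/

namespace ASEP

/-! ### Path sums as iterated one-step recursions -/

section Transfer

variable {R : Type*} [CommRing R]

/-- The total weight, over all paths of length `t` ending at height `j` none of whose steps goes
down by more than one, computed by splitting off the last step. -/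
def transfer (init : ℕ → R) (w : ℕ → ℕ → ℕ → R) : ℕ → ℕ → R
  | 0, j => init j
  | t + 1, j => ∑ x ∈ Finset.range (j + 2), transfer init w t x * w (t + 1) x j

/-- The paths of length `t` ending at height `j` none of whose steps goes down by more than one. -/
def pathsTo : (t : ℕ) → ℕ → Finset (Fin (t + 1) → ℕ)
  | 0, j => {fun _ => j}
  | t + 1, j => (Finset.range (j + 2)).biUnion fun x =>
      (pathsTo t x).image fun p => (Fin.snoc p j : Fin (t + 2) → ℕ)

theorem mem_pathsTo {t j : ℕ} {p : Fin (t + 1) → ℕ} :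
    p ∈ pathsTo t j ↔ p (Fin.last t) = j ∧ ∀ i : Fin t, p i.castSucc ≤ p i.succ + 1 := by
  induction t generalizing j with
  | zero =>
    simp only [pathsTo, Finset.mem_singleton, IsEmpty.forall_iff, and_true]
    constructor
    · rintro rfl; rfl
    · intro h
      funext i
      rw [show i = Fin.last 0 from Fin.ext (by simp), h]
  | succ t ih =>
    simp only [pathsTo, Finset.mem_biUnion, Finset.mem_range, Finset.mem_image]
    constructor
    · rintro ⟨x, hx, q, hq, rfl⟩
      obtain ⟨h1, h2⟩ := ih.1 hq
      refine ⟨by simp, fun i => ?_⟩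
      induction i using Fin.lastCases with
      | last =>
        rw [Fin.succ_last, Fin.snoc_castSucc, Fin.snoc_last, h1]
        omega
      | cast i =>
        rw [← Fin.castSucc_succ, Fin.snoc_castSucc, Fin.snoc_castSucc]
        exact h2 i
    · rintro ⟨h1, h2⟩
      refine ⟨p (Fin.last t).castSucc, ?_, Fin.init p, ih.2 ⟨rfl, fun i => ?_⟩, ?_⟩
      · have := h2 (Fin.last t)
        rw [Fin.succ_last, h1] at this
        omega
      · exact h2 i.castSucc
      · rw [← h1, Fin.snoc_init_self]

theorem stepProd_snoc (w : ℕ → ℕ → ℕ → R) {t : ℕ} (p : Fin (t + 1) → ℕ) (j : ℕ) :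
    stepProd w (Fin.snoc p j : Fin (t + 2) → ℕ)
      = stepProd w p * w (t + 1) (p (Fin.last t)) j := by
  simp only [stepProd, Fin.prod_univ_castSucc, Fin.succ_last, Fin.snoc_last, Fin.snoc_castSucc,
    ← Fin.castSucc_succ, Fin.val_castSucc, Fin.val_last]

theorem sum_pathsTo (init : ℕ → R) (w : ℕ → ℕ → ℕ → R) (t j : ℕ) :
    ∑ p ∈ pathsTo t j, init (p 0) * stepProd w p = transfer init w t j := by
  induction t generalizing j with
  | zero => simp [pathsTo, transfer, stepProd]
  | succ t ih =>
    rw [pathsTo, transfer, Finset.sum_biUnion]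
    · refine Finset.sum_congr rfl fun x _ => ?_
      rw [Finset.sum_image, ← ih, Finset.sum_mul]
      · refine Finset.sum_congr rfl fun p hp => ?_
        rw [stepProd_snoc, (mem_pathsTo.1 hp).1, mul_assoc,
          show (Fin.snoc p j : Fin (t + 2) → ℕ) 0 = p 0 from
            Fin.snoc_castSucc (α := fun _ => ℕ) j p 0]
      · intro p _ q _ h
        exact (Fin.snoc_injective2 (α := fun _ => ℕ) h).1
    · intro x _ y _ hxy
      refine Finset.disjoint_left.2 fun q hq hq' => hxy ?_
      obtain ⟨p, hp, rfl⟩ := Finset.mem_image.1 hq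
      obtain ⟨p', hp', h⟩ := Finset.mem_image.1 hq'
      rw [← (mem_pathsTo.1 hp).1, ← (mem_pathsTo.1 hp').1,
        (Fin.snoc_injective2 (α := fun _ => ℕ) h).1]

/-- Restriction of step weights to the steps allowed by `S`. -/
noncomputable def restrict (S : ℕ → Set ℤ) (w : ℕ → ℕ → ℕ → R) (i x y : ℕ) : R :=
  open Classical in if (y : ℤ) - x ∈ S i then w i x y else 0

open Classical in
theorem stepProd_restrict (S : ℕ → Set ℤ) (w : ℕ → ℕ → ℕ → R) {t : ℕ} (p : Fin (t + 1) → ℕ) :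
    stepProd (restrict S w) p = if HasSteps S p then stepProd w p else 0 := by
  simp only [stepProd, restrict, HasSteps]
  rw [Fintype.prod_ite_zero]
  congr

theorem HasSteps.mem_pathsTo {S : ℕ → Set ℤ} (hS : ∀ i, ∀ s ∈ S i, -1 ≤ s) {t : ℕ}
    {p : Fin (t + 1) → ℕ} (h : HasSteps S p) : p ∈ pathsTo t (p (Fin.last t)) := by
  refine ASEP.mem_pathsTo.2 ⟨rfl, fun i => ?_⟩
  have := hS _ _ (h i)
  omega

theorem neg_one_le_of_mem_dyckSteps (i : ℕ) (s : ℤ) (hs : s ∈ dyckSteps i) : -1 ≤ s := by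
  rcases hs with rfl | rfl <;> norm_num

theorem neg_one_le_of_mem_jumpSteps (i : ℕ) (s : ℤ) (hs : s ∈ jumpSteps i) : -1 ≤ s := by
  unfold jumpSteps at hs
  split_ifs at hs
  · rw [hs]
  · obtain ⟨k, rfl⟩ := hs
    omega

open Classical in
/-- A finite sum of path weights is a value of the transfer recursion. -/
theorem finsum_mem_eq_transfer {S : ℕ → Set ℤ} (hS : ∀ i, ∀ s ∈ S i, -1 ≤ s) (I : ℕ → Prop)
    (init : ℕ → R) (w : ℕ → ℕ → ℕ → R) (t j : ℕ) :
    ∑ᶠ p ∈ {p : Fin (t + 1) → ℕ | HasSteps S p ∧ I (p 0) ∧ p (Fin.last t) = j},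
        init (p 0) * stepProd w p
      = transfer (fun x => if I x then init x else 0) (restrict S w) t j := by
  rw [← sum_pathsTo, finsum_mem_def, finsum_eq_sum_of_support_subset (s := pathsTo t j)]
  · refine Finset.sum_congr rfl fun p hp => ?_
    rw [stepProd_restrict, Set.indicator_apply]
    have := (mem_pathsTo.1 hp).1
    by_cases h1 : HasSteps S p <;> by_cases h2 : I (p 0) <;> simp [h1, h2, this]
  · intro p hp
    have hp' := Set.mem_of_indicator_ne_zero hp
    have := hp'.1.mem_pathsTo hS
    rwa [hp'.2.2] at this

theorem finite_paths {S : ℕ → Set ℤ} (hS : ∀ i, ∀ s ∈ S i, -1 ≤ s) (I : ℕ → Prop) (t j : ℕ) :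
    {p : Fin (t + 1) → ℕ | HasSteps S p ∧ I (p 0) ∧ p (Fin.last t) = j}.Finite := by
  refine (pathsTo t j).finite_toSet.subset fun p hp => ?_
  have := hp.1.mem_pathsTo hS
  rwa [hp.2.2] at this

theorem sum_restrict_dyckSteps_zero (f : ℕ → R) (w : ℕ → ℕ → ℕ → R) (i : ℕ) :
    ∑ x ∈ Finset.range 2, f x * restrict dyckSteps w i x 0 = f 1 * w i 1 0 := by
  simp [Finset.sum_range_succ, restrict, dyckSteps]

theorem sum_restrict_dyckSteps_succ (f : ℕ → R) (w : ℕ → ℕ → ℕ → R) (i j : ℕ) :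
    ∑ x ∈ Finset.range (j + 3), f x * restrict dyckSteps w i x (j + 1)
      = f j * w i j (j + 1) + f (j + 2) * w i (j + 2) (j + 1) := by
  rw [Finset.sum_range_succ, Finset.sum_range_succ, Finset.sum_range_succ, Finset.sum_eq_zero]
  · have h1 : ((j + 1 : ℕ) : ℤ) - (j : ℕ) ∈ dyckSteps i := by simp [dyckSteps]
    have h2 : ((j + 1 : ℕ) : ℤ) - (j + 1 : ℕ) ∉ dyckSteps i := by simp [dyckSteps]
    have h3 : ((j + 1 : ℕ) : ℤ) - (j + 2 : ℕ) ∈ dyckSteps i := by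
      left; push_cast; ring
    simp only [restrict, if_pos h1, if_neg h2, if_pos h3]
    ring
  · intro x hx
    have hx := Finset.mem_range.1 hx
    have : ((j + 1 : ℕ) : ℤ) - x ∉ dyckSteps i := by
      simp only [dyckSteps, Set.mem_insert_iff, Set.mem_singleton_iff]
      omega
    rw [restrict, if_neg this, mul_zero]

theorem sum_range_two_mul (f : ℕ → R) (n : ℕ) :
    ∑ x ∈ Finset.range (2 * n), f x = ∑ i ∈ Finset.range n, (f (2 * i) + f (2 * i + 1)) := by
  induction n with
  | zero => simp
  | succ n ih => rw [Nat.mul_succ, Finset.sum_range_succ, Finset.sum_range_succ, ih,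
      Finset.sum_range_succ, add_assoc]

end Transfer

/-! ### Consequences of the DEHP relations -/

section Representation

variable {R : Type*} [CommRing R] {M : Type*} [AddCommGroup M] [Module R M]

/-- The alternating product `D E D E ⋯` of `t` factors. -/
def altProd (D E : Module.End R M) : ℕ → Module.End R M
  | 0 => 1
  | t + 1 => altProd D E t * if Even t then D else E

theorem altProd_two_mul (D E : Module.End R M) (L : ℕ) : altProd D E (2 * L) = (D * E) ^ L := by
  induction L with
  | zero => rfl
  | succ L ih =>
    have h : ¬ Even (2 * L + 1) := by simp
    rw [Nat.mul_succ, altProd, altProd, ih, if_neg h, if_pos (even_two_mul L), pow_succ, mul_assoc]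

theorem altProd_succ_of_even (D E : Module.End R M) {t : ℕ} (h : Even t) (v : M) :
    altProd D E (t + 1) v = altProd D E t (D v) := by
  rw [altProd, if_pos h, Module.End.mul_apply]

theorem altProd_succ_of_odd (D E : Module.End R M) {t : ℕ} (h : Odd t) (v : M) :
    altProd D E (t + 1) v = altProd D E t (E v) := by
  rw [altProd, if_neg (Nat.not_even_iff_odd.2 h), Module.End.mul_apply]

namespace IsDEHP

variable {α β : Rˣ} {D E : Module.End R M} {W : M →ₗ[R] R} {V : M}

theorem map_E (h : IsDEHP α β D E W V) (v : M) : W (E v) = ((α⁻¹ : Rˣ) : R) * W v :=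
  LinearMap.congr_fun h.left_eigenvector v

theorem map_E_pow (h : IsDEHP α β D E W V) (n : ℕ) (v : M) :
    W ((E ^ n) v) = ((α⁻¹ : Rˣ) : R) ^ n * W v := by
  induction n with
  | zero => simp
  | succ n ih => rw [pow_succ', Module.End.mul_apply, h.map_E, ih, pow_succ', mul_assoc]

theorem D_pow_apply (h : IsDEHP α β D E W V) (n : ℕ) :
    (D ^ n) V = ((β⁻¹ : Rˣ) : R) ^ n • V := by
  induction n with
  | zero => simp
  | succ n ih =>
    rw [pow_succ', Module.End.mul_apply, ih, map_smul, h.right_eigenvector, smul_smul, pow_succ]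

theorem D_E_apply (h : IsDEHP α β D E W V) (v : M) : D (E v) = D v + E v :=
  (LinearMap.congr_fun h.add_eq_mul v).symm

theorem D_E_pow_apply (h : IsDEHP α β D E W V) (n : ℕ) :
    D ((E ^ n) V) = ((β⁻¹ : Rˣ) : R) • V + ∑ i ∈ Finset.range n, (E ^ (i + 1)) V := by
  induction n with
  | zero => simp [h.right_eigenvector]
  | succ n ih =>
    rw [pow_succ', Module.End.mul_apply, h.D_E_apply, ih, Finset.sum_range_succ, pow_succ',
      Module.End.mul_apply, add_assoc]

/-- This one-sided inverse is the source of the `±1` steps: `D` and `E` are `1` plus a lowering and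
a raising operator. -/
theorem sub_one_mul_sub_one (h : IsDEHP α β D E W V) : (D - 1) * (E - 1) = 1 := by
  rw [sub_mul, mul_sub, ← h.add_eq_mul]
  simp

theorem E_T_pow (n : ℕ) (v : M) :
    E (((E - 1) ^ n) v) = ((E - 1) ^ n) v + ((E - 1) ^ (n + 1)) v := by
  rw [pow_succ', Module.End.mul_apply, LinearMap.sub_apply, Module.End.one_apply]
  abel

theorem D_T_pow (h : IsDEHP α β D E W V) (n : ℕ) (v : M) :
    D (((E - 1) ^ (n + 1)) v) = ((E - 1) ^ n) v + ((E - 1) ^ (n + 1)) v := by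
  have h1 : (D - 1) (((E - 1) ^ (n + 1)) v) = ((E - 1) ^ n) v := by
    rw [pow_succ', Module.End.mul_apply, ← Module.End.mul_apply, h.sub_one_mul_sub_one]
    rfl
  rw [← h1]
  simp

theorem map_T_pow (h : IsDEHP α β D E W V) (n : ℕ) (v : M) :
    W (((E - 1) ^ n) v) = (((α⁻¹ : Rˣ) : R) - 1) ^ n * W v := by
  induction n with
  | zero => simp
  | succ n ih =>
    rw [pow_succ', Module.End.mul_apply, LinearMap.sub_apply, map_sub, h.map_E,
      Module.End.one_apply, ih]
    ring

theorem S_pow_apply (h : IsDEHP α β D E W V) (n : ℕ) :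
    ((D - 1) ^ n) V = (((β⁻¹ : Rˣ) : R) - 1) ^ n • V := by
  induction n with
  | zero => simp
  | succ n ih =>
    rw [pow_succ', Module.End.mul_apply, ih, map_smul, LinearMap.sub_apply, h.right_eigenvector,
      Module.End.one_apply, pow_succ]
    module

end IsDEHP

end Representation

/-! ### Jump paths -/

section JumpPaths

variable {R : Type*} [CommRing R] {M : Type*} [AddCommGroup M] [Module R M]
  {α β : Rˣ} {D E : Module.End R M} {W : M →ₗ[R] R} {V : M}

theorem mem_jumpSteps_of_even {i : ℕ} (hi : Even i) {s : ℤ} : s ∈ jumpSteps i ↔ s = -1 := by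
  rw [jumpSteps, if_pos hi, Set.mem_singleton_iff]

theorem mem_jumpSteps_of_odd {i : ℕ} (hi : Odd i) {s : ℤ} :
    s ∈ jumpSteps i ↔ Odd s ∧ -1 ≤ s := by
  rw [jumpSteps, if_neg (Nat.not_even_iff_odd.2 hi)]
  constructor
  · rintro ⟨k, rfl⟩
    exact ⟨⟨k - 1, by ring⟩, by omega⟩
  · rintro ⟨⟨k, rfl⟩, h⟩
    exact ⟨(k + 1).toNat, by omega⟩

-- An odd step into height `2 k + 2` comes from one of the heights `1, 3, …, 2 k + 3`, matching the
-- terms of `D_E_pow_apply` for `E ^ (k + 1) V`; an even step turns `E ^ k` into `E ^ (k + 1)`.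
-- Height zero can be left out: it occurs only before an even step, which would have to go down.
open Classical in
theorem transfer_jump (h : IsDEHP α β D E W V) (b : R) (hb : b = ((β⁻¹ : Rˣ) : R)) (t : ℕ) :
    ∀ j, Odd (j + t) → 0 < j →
    transfer (fun x => if (∃ k, x = 2 * k + 1) then ((α⁻¹ : Rˣ) : R) ^ (x / 2) else 0)
      (restrict jumpSteps fun i x y => if Odd i ∧ x = 1 ∧ 2 ≤ y ∧ Even y then b else 1) t j
      = W (altProd D E t ((E ^ (j / 2)) V)) := by
  induction t with
  | zero =>
    intro j hj _
    rw [transfer, if_pos (show ∃ k, j = 2 * k + 1 from hj), altProd, Module.End.one_apply, h.map_E_pow, h.normalised, mul_one]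
  | succ t ih =>
    intro j hj h0
    rw [transfer]
    rcases Nat.even_or_odd t with ht | ht
    · obtain ⟨k, rfl⟩ : ∃ k, j = 2 * k + 2 := by
        obtain ⟨i, hi⟩ := ht
        obtain ⟨l, hl⟩ := hj
        exact ⟨l - i - 1, by omega⟩
      have ho : Odd (t + 1) := ht.add_one
      rw [altProd_succ_of_even _ _ ht, show (2 * k + 2) / 2 = k + 1 by omega, h.D_E_pow_apply,
        show 2 * k + 2 + 2 = 2 * (k + 2) by ring, sum_range_two_mul, Finset.sum_range_succ',
        map_add, map_add, map_sum, map_sum, add_comm (W _)]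
      congr 1
      · refine Finset.sum_congr rfl fun i hi => ?_
        have hi := Finset.mem_range.1 hi
        have h1 : ((2 * k + 2 : ℕ) : ℤ) - (2 * (i + 1) : ℕ) ∉ jumpSteps (t + 1) := by
          rw [mem_jumpSteps_of_odd ho]
          rintro ⟨⟨l, hl⟩, -⟩
          omega
        have h2 : ((2 * k + 2 : ℕ) : ℤ) - (2 * (i + 1) + 1 : ℕ) ∈ jumpSteps (t + 1) := by
          rw [mem_jumpSteps_of_odd ho]
          exact ⟨⟨k - i - 1, by push_cast; ring⟩, by omega⟩
        rw [restrict, if_neg h1, mul_zero, zero_add, restrict, if_pos h2,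
          if_neg (fun h => by omega), mul_one, ih _ (by rw [add_assoc, add_comm 1 t]
                                                        exact (even_two_mul _).add_odd ho)
          (by omega), show (2 * (i + 1) + 1) / 2 = i + 1 by omega]
      · have h1 : ((2 * k + 2 : ℕ) : ℤ) - (2 * 0 : ℕ) ∉ jumpSteps (t + 1) := by
          rw [mem_jumpSteps_of_odd ho]
          rintro ⟨⟨l, hl⟩, -⟩
          omega
        have h2 : ((2 * k + 2 : ℕ) : ℤ) - (2 * 0 + 1 : ℕ) ∈ jumpSteps (t + 1) := by
          rw [mem_jumpSteps_of_odd ho]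
          exact ⟨⟨k, by push_cast; ring⟩, by omega⟩
        rw [restrict, if_neg h1, mul_zero, zero_add, restrict, if_pos h2,
          if_pos ⟨ho, by omega, by omega, ⟨k + 1, by ring⟩⟩,
          ih _ (by rw [add_comm]; exact ho) (by omega), map_smul, map_smul, ← hb, smul_eq_mul,
          mul_comm]
        rfl
    · have ho : Even (t + 1) := ht.add_one
      obtain ⟨k, rfl⟩ : ∃ k, j = 2 * k + 1 := by
        obtain ⟨i, hi⟩ := ht
        obtain ⟨l, hl⟩ := hj
        exact ⟨l - i - 1, by omega⟩
      rw [altProd_succ_of_odd _ _ ht, Finset.sum_range_succ, Finset.sum_eq_zero, zero_add,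
        restrict, if_pos, if_neg (fun h => Nat.not_even_iff_odd.2 h.1 ho), mul_one,
        ih _ _ (by omega), show (2 * k + 1 + 1) / 2 = (2 * k + 1) / 2 + 1 by omega, pow_succ',
        Module.End.mul_apply]
      · rw [add_right_comm]
        exact (ho.add_odd ⟨k, rfl⟩).elim fun m hm => ⟨m, by omega⟩
      · rw [mem_jumpSteps_of_even ho]
        push_cast
        ring
      · intro x hx
        have hx := Finset.mem_range.1 hx
        rw [restrict, if_neg, mul_zero]
        rw [mem_jumpSteps_of_even ho]
        omega

theorem finite_R₁ (L : ℕ) : (R₁ L).Finite :=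
  finite_paths neg_one_le_of_mem_jumpSteps (fun x => ∃ k, x = 2 * k + 1) (2 * L) 1

theorem normalisation_eq_sum_R₁ (h : IsDEHP α β D E W V) (L : ℕ) :
    normalisation D E W V L
      = ∑ᶠ p ∈ R₁ L, weight₁ ((α⁻¹ : Rˣ) : R) ((β⁻¹ : Rˣ) : R) p := by
  have h1 := finsum_mem_eq_transfer neg_one_le_of_mem_jumpSteps (fun x => ∃ k, x = 2 * k + 1)
    (fun x => ((α⁻¹ : Rˣ) : R) ^ (x / 2))
    (fun i x y => if Odd i ∧ x = 1 ∧ 2 ≤ y ∧ Even y then ((β⁻¹ : Rˣ) : R) else 1) (2 * L) 1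
  have h2 := transfer_jump h _ rfl (2 * L) 1 ⟨L, by ring⟩ one_pos
  rw [altProd_two_mul] at h2
  refine h2.symm.trans (Eq.trans ?_ h1.symm)
  congr!

end JumpPaths

/-! ### Dyck-type paths -/

section DyckTypePaths

variable {R : Type*} [CommRing R] {M : Type*} [AddCommGroup M] [Module R M]
  {α β : Rˣ} {D E : Module.End R M} {W : M →ₗ[R] R} {V : M}

/-- The step weights of the Dyck-type paths. -/
def dyckWeight (a b κ : R) (_ x y : ℕ) : R :=
  if (x = 1 ∧ y = 2) ∨ (x = 2 ∧ y = 1) then κ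
  else if x = 1 ∧ y = 0 then b
  else if x = 0 ∧ y = 1 then a
  else 1

/-- Put `u = E V - a V`. Then `D V = b V`, `E V = a V + u` and `D u = κ ^ 2 V + u` are the steps
near height one, `E_T_pow` and `D_T_pow` those higher up, and `W u = 0` says that paths start at
height one only. The factor `κ` on the left splits `κ ^ 2` between the steps `1 → 2` and `2 → 1`
without dividing by `κ`. -/
theorem transfer_dyckWeight (h : IsDEHP α β D E W V) {a b κ : R} (ha : a = ((α⁻¹ : Rˣ) : R))
    (hb : b = ((β⁻¹ : Rˣ) : R)) (hκ : κ ^ 2 = a + b - a * b) (t : ℕ) :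
    (Odd t → transfer (fun x => if x = 1 then 1 else 0) (restrict dyckSteps (dyckWeight a b κ)) t 0
      = W (altProd D E t V)) ∧
    (Even t → transfer (fun x => if x = 1 then 1 else 0)
      (restrict dyckSteps (dyckWeight a b κ)) t 1 = W (altProd D E t V)) ∧
    ∀ j, Odd (j + t) → κ * transfer (fun x => if x = 1 then 1 else 0)
      (restrict dyckSteps (dyckWeight a b κ)) t (j + 2)
        = W (altProd D E t (((E - 1) ^ (j / 2)) (E V - a • V))) := by
  have hDV : D V = b • V := by rw [hb, h.right_eigenvector]
  induction t with
  | zero =>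
    refine ⟨fun h0 => by simp at h0, fun _ => ?_, fun j _ => ?_⟩
    · simp [transfer, altProd, h.normalised]
    · rw [transfer, if_neg (by omega), altProd, Module.End.one_apply, h.map_T_pow, map_sub,
        h.map_E, map_smul, ha]
      simp
  | succ t ih =>
    obtain ⟨ih0, ih1, ih2⟩ := ih
    refine ⟨fun ht => ?_, fun ht => ?_, fun j hj => ?_⟩
    · have ht : Even t := by rwa [Nat.odd_add_one, Nat.not_odd_iff_even] at ht
      rw [transfer, sum_restrict_dyckSteps_zero, ih1 ht, altProd_succ_of_even _ _ ht, hDV,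
        map_smul, map_smul, smul_eq_mul, mul_comm]
      simp [dyckWeight]
    · have ht : Odd t := by rwa [Nat.even_add_one, Nat.not_even_iff_odd] at ht
      have h2 := ih2 0 (by rwa [zero_add])
      simp only [zero_add, Nat.zero_div, pow_zero, Module.End.one_apply, map_sub, map_smul] at h2
      rw [transfer, sum_restrict_dyckSteps_succ, ih0 ht, altProd_succ_of_odd _ _ ht]
      simp only [dyckWeight, smul_eq_mul] at h2 ⊢
      norm_num
      linear_combination h2
    · rw [transfer, sum_restrict_dyckSteps_succ]
      rcases j with - | j
      · have ht : Even t := by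
          rw [zero_add] at hj
          rwa [Nat.odd_add_one, Nat.not_odd_iff_even] at hj
        have h3 := ih2 1 (by rw [add_comm]; exact ht.add_one)
        have h1 := ih1 ht
        -- The coefficient of `V` is `b` from `D E V = D V + E V`, plus `a - a b`; this is where the
        -- value of `κ ^ 2` enters.
        have hDu : D (E V - a • V) = (E V - a • V) + (κ ^ 2) • V := by
          rw [map_sub, h.D_E_apply, map_smul, hDV, hκ]
          module
        simp only [pow_zero, Module.End.one_apply, zero_add,
          altProd_succ_of_even _ _ ht, hDu, map_add, map_smul, smul_eq_mul,
          show 1 / 2 = 0 from rfl] at h3 ⊢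
        rw [← h3, ← h1]
        simp only [dyckWeight]
        norm_num
        ring
      · have hw1 : dyckWeight a b κ (t + 1) (j + 1 + 1) (j + 1 + 1 + 1) = 1 := by
          simp [dyckWeight]
        have hw2 : dyckWeight a b κ (t + 1) (j + 1 + 1 + 2) (j + 1 + 1 + 1) = 1 := by
          simp [dyckWeight]
        obtain ⟨m, hm⟩ := hj
        have h2 := ih2 j ⟨m - 1, by omega⟩
        have h4 := ih2 (j + 2) ⟨m, by omega⟩
        rw [hw1, hw2, mul_one, mul_one, mul_add, h2]
        rw [show j + 1 + 1 + 2 = j + 2 + 2 from rfl, h4, ← map_add, ← map_add]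
        rcases Nat.even_or_odd t with ht | ht
        · obtain ⟨i, hi⟩ := ht
          obtain ⟨l, rfl⟩ : ∃ l, j = 2 * l + 1 := ⟨m - i - 1, by omega⟩
          rw [altProd_succ_of_even _ _ ⟨i, hi⟩, show (2 * l + 1 + 1) / 2 = l + 1 by omega,
            h.D_T_pow, show (2 * l + 1) / 2 = l by omega,
            show (2 * l + 1 + 2) / 2 = l + 1 by omega]
        · obtain ⟨i, hi⟩ := ht
          obtain ⟨l, rfl⟩ : ∃ l, j = 2 * l := ⟨m - i - 1, by omega⟩
          rw [altProd_succ_of_odd _ _ ⟨i, hi⟩, show (2 * l + 1) / 2 = l by omega,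
            IsDEHP.E_T_pow, show 2 * l / 2 = l by omega, show (2 * l + 2) / 2 = l + 1 by omega]

theorem finite_R₃ (L : ℕ) : (R₃ L).Finite :=
  finite_paths neg_one_le_of_mem_dyckSteps (fun x => x = 1) (2 * L) 1

theorem normalisation_eq_sum_R₃ (h : IsDEHP α β D E W V) (κ : R)
    (hκ : κ ^ 2 = ((α⁻¹ : Rˣ) : R) + ((β⁻¹ : Rˣ) : R) - ((α⁻¹ : Rˣ) : R) * ((β⁻¹ : Rˣ) : R))
    (L : ℕ) :
    normalisation D E W V L
      = ∑ᶠ p ∈ R₃ L, weight₃ ((α⁻¹ : Rˣ) : R) ((β⁻¹ : Rˣ) : R) κ p := by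
  have h1 := finsum_mem_eq_transfer neg_one_le_of_mem_dyckSteps (fun x => x = 1)
    (fun _ => (1 : R)) (dyckWeight ((α⁻¹ : Rˣ) : R) ((β⁻¹ : Rˣ) : R) κ) (2 * L) 1
  have h2 := (transfer_dyckWeight h rfl rfl hκ (2 * L)).2.1 (even_two_mul L)
  rw [altProd_two_mul] at h2
  refine h2.symm.trans (Eq.trans ?_ (h1.symm.trans ?_))
  · congr!
  · simp only [one_mul]
    rfl

end DyckTypePaths

/-! ### Statistics of returns to height one -/

section Returns

variable {R : Type*} [CommRing R]

/-- The sum of `x n` over the positive paths with steps `±1` of length `t` from height one to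
height `j`, where `n` is the number of steps from height two to height one. -/
def returnSum : ℕ → ℕ → (ℕ → R) → R
  | 0, j, x => if j = 1 then x 0 else 0
  | _ + 1, 0, _ => 0
  | t + 1, 1, x => returnSum t 2 fun n => x (n + 1)
  | t + 1, j + 2, x => returnSum t (j + 1) x + returnSum t (j + 3) x

theorem returnSum_zero_right (t : ℕ) (x : ℕ → R) : returnSum t 0 x = 0 := by
  cases t <;> simp [returnSum]

theorem returnSum_add (t j : ℕ) (x y : ℕ → R) :
    returnSum t j (fun n => x n + y n) = returnSum t j x + returnSum t j y := by
  induction t generalizing j x y with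
  | zero => by_cases h : j = 1 <;> simp [returnSum, h]
  | succ t ih =>
    rcases j with - | - | j
    · simp [returnSum]
    · simp only [returnSum, ih]
    · simp only [returnSum, ih]
      ring

theorem returnSum_mul (t j : ℕ) (r : R) (x : ℕ → R) :
    returnSum t j (fun n => r * x n) = r * returnSum t j x := by
  induction t generalizing j x with
  | zero => simp [returnSum]
  | succ t ih =>
    rcases j with - | - | j
    · simp [returnSum]
    · simp only [returnSum, ih]
    · simp only [returnSum, ih]
      ring

/-- Only height one is wanted; the other heights close the induction on the last step. Shifting `x`
turns the sum for height two into the one for height one, and the `x 0` term from height three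
completes the sum for height two. -/
theorem returnSum_add_two_aux (t : ℕ) : ∀ x : ℕ → R,
    returnSum (t + 2) 1 x
      = returnSum t 1 (fun n => ∑ i ∈ Finset.range (n + 1), x (i + 1)) ∧
    returnSum (t + 2) 2 x = returnSum t 2 (fun n => ∑ i ∈ Finset.range (n + 2), x i) ∧
    ∀ j, returnSum (t + 2) (j + 3) x
      = returnSum t (j + 3) (fun n => ∑ i ∈ Finset.range (n + 2), x i)
        + returnSum t (j + 1) fun _ => x 0 := by
  induction t with
  | zero =>
    intro x
    refine ⟨by simp [returnSum], by simp [returnSum], fun j => ?_⟩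
    rcases j with - | j <;> simp [returnSum]
  | succ t ih =>
    intro x
    refine ⟨?_, ?_, fun j => ?_⟩
    · rw [returnSum, (ih _).2.1, returnSum]
    · rw [returnSum, (ih x).1, (ih x).2.2 0, returnSum]
      -- The term `i = 0` is exactly the correction coming from height three.
      have h2 : returnSum t 1 (fun n => ∑ i ∈ Finset.range (n + 2), x i)
          = returnSum t 1 (fun n => ∑ i ∈ Finset.range (n + 1), x (i + 1))
            + returnSum t 1 fun _ => x 0 := by
        rw [← returnSum_add]
        congr 1
        funext n
        exact Finset.sum_range_succ' _ _
      rw [h2]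
      ring
    · rw [returnSum, (ih x).2.2 (j + 1)]
      rcases j with - | j
      · rw [(ih x).2.1, returnSum, returnSum]
        ring
      · rw [(ih x).2.2 j, returnSum, returnSum]
        ring

/-- This is the Catalan generating tree: a node labelled `n` has children labelled `1, …, n + 1`. -/
theorem returnSum_add_two (t : ℕ) (x : ℕ → R) :
    returnSum (t + 2) 1 x
      = returnSum t 1 (fun n => ∑ i ∈ Finset.range (n + 1), x (i + 1)) :=
  (returnSum_add_two_aux t x).1

end Returns

/-! ### Ordered homogeneous sums in `E` and `D` -/

section HomogeneousSum

/-- The ordered complete homogeneous sum `∑ a ^ i * b ^ j` over `i + j = n`. -/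
def homSum {A : Type*} [Semiring A] (a b : A) : ℕ → A
  | 0 => 1
  | n + 1 => a * homSum a b n + b ^ (n + 1)

theorem homSum_succ {R : Type*} [CommRing R] (a b : R) (n : ℕ) :
    homSum a b (n + 1) = b * homSum a b n + a ^ (n + 1) := by
  induction n with
  | zero => simp [homSum, add_comm]
  | succ n ih =>
    have e : homSum a b (n + 2) = a * homSum a b (n + 1) + b ^ (n + 2) := rfl
    have e' : homSum a b (n + 1) = a * homSum a b n + b ^ (n + 1) := rfl
    linear_combination e + a * ih - b * e'

variable {R : Type*} [CommRing R] {M : Type*} [AddCommGroup M] [Module R M]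
  {α β : Rˣ} {D E : Module.End R M} {W : M →ₗ[R] R} {V : M}

namespace IsDEHP

theorem pow_mul_eq_sum (h : IsDEHP α β D E W V) (n : ℕ) :
    D ^ (n + 1) * E = ∑ i ∈ Finset.range (n + 1), D ^ (i + 1) + E := by
  induction n with
  | zero => simpa using h.add_eq_mul.symm
  | succ n ih =>
    rw [pow_succ', mul_assoc, ih, mul_add, ← h.add_eq_mul, Finset.mul_sum,
      Finset.sum_range_succ' _ (n + 1)]
    simp only [← pow_succ']
    rw [zero_add, pow_one, add_assoc]

/-- Moving the new `E` to the left through the powers of `D` with `D E = D + E` restores the order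
`E` before `D`; the result obeys the rule of `returnSum_add_two`. -/
theorem homSum_mul (h : IsDEHP α β D E W V) (n : ℕ) :
    homSum E D n * (D * E) = ∑ i ∈ Finset.range (n + 1), homSum E D (i + 1) := by
  induction n with
  | zero => simp [homSum, ← h.add_eq_mul, add_comm]
  | succ n ih =>
    rw [homSum, add_mul, mul_assoc, ih, ← mul_assoc (D ^ (n + 1)), ← pow_succ, h.pow_mul_eq_sum,
      Finset.mul_sum, Finset.sum_range_succ' _ (n + 1), Finset.sum_range_succ' _ (n + 1)]
    simp only [homSum, Finset.sum_add_distrib]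
    simp only [zero_add, pow_one, mul_one, add_assoc]
    rw [add_comm D E]

/-- In each ordered monomial `W` absorbs the `E`s on the left and `V` the `D`s on the right. -/
theorem map_homSum (h : IsDEHP α β D E W V) (n : ℕ) :
    W (homSum E D n V) = homSum ((α⁻¹ : Rˣ) : R) ((β⁻¹ : Rˣ) : R) n := by
  induction n with
  | zero => simp [homSum, h.normalised]
  | succ n ih =>
    rw [homSum, homSum, LinearMap.add_apply, map_add, Module.End.mul_apply, h.map_E, ih,
      h.D_pow_apply, map_smul, h.normalised, smul_eq_mul, mul_one]

/-- The vector is arbitrary so that the induction can replace `v` by `D E v`. -/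
theorem returnSum_eq (h : IsDEHP α β D E W V) (L : ℕ) (v : M) :
    returnSum (2 * L) 1 (fun n => W (homSum E D n v)) = W (((D * E) ^ L) v) := by
  induction L generalizing v with
  | zero => simp [returnSum, homSum]
  | succ L ih =>
    rw [Nat.mul_succ, returnSum_add_two, pow_succ, Module.End.mul_apply, ← ih]
    congr 1
    funext n
    rw [← Module.End.mul_apply, h.homSum_mul, LinearMap.sum_apply, map_sum]

theorem normalisation_eq_returnSum (h : IsDEHP α β D E W V) (L : ℕ) :
    normalisation D E W V L
      = returnSum (2 * L) 1 (homSum ((α⁻¹ : Rˣ) : R) ((β⁻¹ : Rˣ) : R)) := by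
  rw [normalisation, ← h.returnSum_eq]
  simp only [h.map_homSum]

end IsDEHP

end HomogeneousSum

/-! ### Canonical paths -/

section CanonicalPaths

variable {R : Type*} [CommRing R]

/-- The step weights of a canonical path with marked vertex `k`, zero for steps that violate
positivity or the condition that the marked vertex has height one. -/
def markWeight (a b : R) (k i x y : ℕ) : R :=
  if y ≠ 0 ∧ (i = k → y = 1) then
    (if x = 2 ∧ y = 1 ∧ i ≤ k then a else if x = 1 ∧ y = 2 ∧ k < i then b else 1)
  else 0

/-- The total weight of the canonical paths of length `t` to height `j` with mark `k`. -/
noncomputable def markSum (a b : R) (k t j : ℕ) : R :=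
  transfer (fun x => if x = 1 then 1 else 0) (restrict dyckSteps (markWeight a b k)) t j

theorem markSum_succ_zero (a b : R) (k t : ℕ) : markSum a b k (t + 1) 0 = 0 := by
  rw [markSum, transfer, sum_restrict_dyckSteps_zero]
  simp [markWeight]

theorem markSum_succ_succ (a b : R) (k t j : ℕ) :
    markSum a b k (t + 1) (j + 1) = markSum a b k t j * markWeight a b k (t + 1) j (j + 1)
      + markSum a b k t (j + 2) * markWeight a b k (t + 1) (j + 2) (j + 1) := by
  rw [markSum, transfer, sum_restrict_dyckSteps_succ]
  rfl

theorem markSum_of_lt (a b : R) {k t : ℕ} (hk : t < k) (j : ℕ) :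
    markSum a b k t j = returnSum t j fun n => a ^ n := by
  induction t generalizing j with
  | zero => simp [markSum, transfer, returnSum]
  | succ t ih =>
    have ih := ih (by omega)
    have h1 : t + 1 ≠ k := by omega
    have h2 : t + 1 ≤ k := by omega
    have h3 : ¬ k < t + 1 := by omega
    rcases j with - | - | j
    · rw [markSum_succ_zero, returnSum_zero_right]
    · simp only [pow_succ', returnSum, returnSum_mul]
      rw [markSum_succ_succ, ih, ih, returnSum_zero_right]
      simp [markWeight, h1, h2, mul_comm]
    · rw [markSum_succ_succ, ih, ih, returnSum]
      simp [markWeight, h1, h3]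

theorem markSum_self (a b : R) (t j : ℕ) :
    markSum a b (t + 1) (t + 1) j = if j = 1 then returnSum (t + 1) 1 fun n => a ^ n else 0 := by
  rcases j with - | - | j
  · rw [markSum_succ_zero, if_neg (by norm_num)]
  · simp only [zero_add, if_true, pow_succ', returnSum, returnSum_mul]
    rw [← zero_add 1, ← add_assoc, add_zero, markSum_succ_succ, markSum_of_lt _ _ (by omega),
      markSum_of_lt _ _ (by omega), returnSum_zero_right]
    simp [markWeight, mul_comm]
  · rw [markSum_succ_succ, if_neg (by omega)]
    simp [markWeight]

/-- Away from height one the path is inside an unfinished excursion, whose initial step up already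
carries `b` while its return is not yet counted; hence the extra factor. At height one the new mark
at the endpoint adds `a ^ n`, which is the recursion `homSum_succ`. -/
theorem sum_markSum (a b : R) (t j : ℕ) :
    ∑ k ∈ Finset.range (t + 1), markSum a b k t j
      = (if j = 1 then 1 else b) * returnSum t j (homSum a b) := by
  induction t generalizing j with
  | zero => by_cases h : j = 1 <;> simp [markSum, transfer, returnSum, homSum, h]
  | succ t ih =>
    rw [Finset.sum_range_succ, markSum_self]
    rcases j with - | j
    · simp [markSum_succ_zero, returnSum_zero_right]
    have hw : ∀ k ∈ Finset.range (t + 1), markSum a b k (t + 1) (j + 1)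
        = markSum a b k t j * (if j = 1 then b else 1) + markSum a b k t (j + 2) := by
      intro k hk
      have hk := Finset.mem_range.1 hk
      have h1 : t + 1 ≠ k := by omega
      have h2 : ¬ t + 1 ≤ k := by omega
      rw [markSum_succ_succ]
      simp [markWeight, h1, h2, hk]
    rw [Finset.sum_congr rfl hw, Finset.sum_add_distrib, ← Finset.sum_mul, ih, ih]
    rcases j with - | j
    · simp only [returnSum_zero_right, zero_add, returnSum, homSum_succ, returnSum_add,
        returnSum_mul]
      simp
    · simp only [returnSum]
      rcases j with - | j
      · simp
        ring
      · simp
        ring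

/-- Steps see every vertex but the initial one, so `h0` supplies its positivity and the condition
for a mark placed there. -/
theorem stepProd_markWeight (a b : R) {t : ℕ} (q : (Fin (t + 1) → ℕ) × Fin (t + 1))
    (h0 : q.1 0 = 1) :
    stepProd (markWeight a b q.2.val) q.1
      = open Classical in if (∀ i, 0 < q.1 i) ∧ q.1 q.2 = 1 then weight₄ a b q else 0 := by
  have key : (∀ i : Fin t, q.1 i.succ ≠ 0 ∧ (i.val + 1 = q.2.val → q.1 i.succ = 1)) ↔
      (∀ i, 0 < q.1 i) ∧ q.1 q.2 = 1 := by
    obtain ⟨p, k⟩ := q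
    simp only at h0 ⊢
    constructor
    · intro h
      refine ⟨Fin.cases (by omega) fun i => Nat.pos_of_ne_zero (h i).1, ?_⟩
      induction k using Fin.cases with
      | zero => exact h0
      | succ k => exact (h k).2 (by simp)
    · rintro ⟨h1, h2⟩ i
      refine ⟨(h1 _).ne', fun hi => ?_⟩
      rw [← h2]
      congr 1
      exact Fin.ext hi
  simp only [stepProd, markWeight]
  rw [Fintype.prod_ite_zero]
  by_cases h : (∀ i, 0 < q.1 i) ∧ q.1 q.2 = 1
  · rw [if_pos (key.2 h), if_pos h]
    rfl
  · rw [if_neg (mt key.1 h), if_neg h]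

theorem R₄_subset (L : ℕ) :
    R₄ L ⊆ (pathsTo (2 * L) 1 ×ˢ (Finset.univ : Finset (Fin (2 * L + 1))) : Finset _) := by
  rintro q ⟨h1, -, h2, -⟩
  have := h1.mem_pathsTo neg_one_le_of_mem_dyckSteps
  rw [h2] at this
  simpa using this

theorem finite_R₄ (L : ℕ) : (R₄ L).Finite :=
  (Finset.finite_toSet _).subset (R₄_subset L)

theorem finsum_R₄ (a b : R) (L : ℕ) :
    ∑ᶠ q ∈ R₄ L, weight₄ a b q = returnSum (2 * L) 1 (homSum a b) := by
  classical
  rw [finsum_mem_def, finsum_eq_sum_of_support_subset _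
    ((Set.support_indicator_subset).trans (R₄_subset L)), Finset.sum_product_right]
  have h := sum_markSum a b (2 * L) 1
  rw [if_pos rfl, one_mul, Finset.sum_range] at h
  rw [← h]
  refine Finset.sum_congr rfl fun k _ => ?_
  rw [markSum, ← sum_pathsTo]
  refine Finset.sum_congr rfl fun p hp => ?_
  have h1 := (mem_pathsTo.1 hp).1
  rw [Set.indicator_apply, stepProd_restrict]
  by_cases h0 : p 0 = 1
  · rw [if_pos h0, one_mul, stepProd_markWeight a b (p, k) h0]
    by_cases h2 : HasSteps dyckSteps p <;> simp [R₄, h0, h1, h2]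
  · simp [R₄, h0]

end CanonicalPaths

/-! ### Rigged ballot paths -/

section RiggedBallotPaths

variable {R : Type*} [CommRing R]

/-- Paths with steps `±1` of length `t` that start at an odd height. -/
def oddStartPaths (t : ℕ) : Set (Fin (t + 1) → ℕ) :=
  {p | HasSteps dyckSteps p ∧ ∃ k, p 0 = 2 * k + 1}

/-- The extension of a path by a step up. -/
def snocUp {t : ℕ} (p : Fin (t + 1) → ℕ) : Fin (t + 2) → ℕ :=
  Fin.snoc p (p (Fin.last t) + 1)

/-- The extension of a path by a step down (from a positive height). -/
def snocDown {t : ℕ} (p : Fin (t + 1) → ℕ) : Fin (t + 2) → ℕ :=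
  Fin.snoc p (p (Fin.last t) - 1)

theorem hasSteps_snoc {S : ℕ → Set ℤ} {t : ℕ} {p : Fin (t + 1) → ℕ} {y : ℕ} :
    HasSteps S (Fin.snoc p y : Fin (t + 2) → ℕ) ↔
      HasSteps S p ∧ (y : ℤ) - p (Fin.last t) ∈ S (t + 1) := by
  simp only [HasSteps, Fin.forall_fin_succ', Fin.succ_last, Fin.snoc_last, Fin.snoc_castSucc,
    ← Fin.castSucc_succ, Fin.val_castSucc, Fin.val_last]

theorem snoc_zero {t : ℕ} (p : Fin (t + 1) → ℕ) (y : ℕ) :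
    (Fin.snoc p y : Fin (t + 2) → ℕ) 0 = p 0 :=
  Fin.snoc_castSucc (α := fun _ => ℕ) y p 0

theorem snocUp_injective {t : ℕ} : Function.Injective (snocUp (t := t)) :=
  fun _ _ h => (Fin.snoc_injective2 (α := fun _ => ℕ) h).1

theorem snocDown_injective {t : ℕ} : Function.Injective (snocDown (t := t)) :=
  fun _ _ h => (Fin.snoc_injective2 (α := fun _ => ℕ) h).1

theorem oddStartPaths_succ (t : ℕ) :
    oddStartPaths (t + 1) = snocUp '' oddStartPaths t ∪
      snocDown '' {p ∈ oddStartPaths t | 0 < p (Fin.last t)} := by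
  ext q
  constructor
  · rintro ⟨h1, h2⟩
    rw [← Fin.snoc_init_self q, hasSteps_snoc] at h1
    have hq : Fin.init q ∈ oddStartPaths t := ⟨h1.1, h2⟩
    rcases h1.2 with h | h
    · refine Or.inr ⟨Fin.init q, ⟨hq, by omega⟩, ?_⟩
      conv_rhs => rw [← Fin.snoc_init_self q]
      rw [snocDown]
      congr 1
      omega
    · refine Or.inl ⟨Fin.init q, hq, ?_⟩
      conv_rhs => rw [← Fin.snoc_init_self q]
      rw [snocUp]
      congr 1
      rw [Set.mem_singleton_iff] at h
      omega
  · rintro (⟨p, hp, rfl⟩ | ⟨p, ⟨hp, h0⟩, rfl⟩)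
    · refine ⟨hasSteps_snoc.2 ⟨hp.1, Or.inr ?_⟩, ?_⟩
      · rw [Set.mem_singleton_iff]
        push_cast
        ring
      · rw [snocUp, snoc_zero]
        exact hp.2
    · refine ⟨hasSteps_snoc.2 ⟨hp.1, Or.inl ?_⟩, ?_⟩
      · omega
      · rw [snocDown, snoc_zero]
        exact hp.2

theorem disjoint_snocUp_snocDown {t : ℕ} (s s' : Set (Fin (t + 1) → ℕ)) :
    Disjoint (snocUp '' s) (snocDown '' s') := by
  rw [Set.disjoint_left]
  rintro _ ⟨p, -, rfl⟩ ⟨p', -, h⟩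
  obtain ⟨rfl, h⟩ := Fin.snoc_injective2 (α := fun _ => ℕ) h
  omega

theorem odd_add_last {t : ℕ} {p : Fin (t + 1) → ℕ} (hp : p ∈ oddStartPaths t) :
    Odd (p (Fin.last t) + t) := by
  induction t with
  | zero => exact hp.2
  | succ t ih =>
    rw [oddStartPaths_succ] at hp
    rcases hp with ⟨q, hq, rfl⟩ | ⟨q, ⟨hq, h0⟩, rfl⟩
    · obtain ⟨m, hm⟩ := ih hq
      rw [snocUp, Fin.snoc_last]
      exact ⟨m + 1, by omega⟩
    · obtain ⟨m, hm⟩ := ih hq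
      rw [snocDown, Fin.snoc_last]
      exact ⟨m, by omega⟩

/-- The function of heights that vanishes below `j` and at `j + 2 k` is `d ^ (k + m)`. -/
def tailWeight (d : R) (j m x : ℕ) : R :=
  if j ≤ x then d ^ ((x - j) / 2 + m) else 0

variable [TopologicalSpace R] [IsTopologicalRing R]

/-- The last step splits the paths into two disjoint families, so convergence passes from length `t`
to `t + 1` without any double series. -/
theorem hasSum_oddStartPaths_succ {t : ℕ} {f : ℕ → ℕ → R} {r s : R}
    (hr : HasSum (fun p : oddStartPaths t => f (p.1 0) (p.1 (Fin.last t) + 1)) r)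
    (hs : HasSum (fun p : oddStartPaths t =>
      if 0 < p.1 (Fin.last t) then f (p.1 0) (p.1 (Fin.last t) - 1) else 0) s) :
    HasSum (fun p : oddStartPaths (t + 1) => f (p.1 0) (p.1 (Fin.last (t + 1)))) (r + s) := by
  have key : HasSum ((fun p : Fin (t + 2) → ℕ => f (p 0) (p (Fin.last (t + 1)))) ∘
      ((↑) : (snocUp '' oddStartPaths t ∪ snocDown '' {p ∈ oddStartPaths t | 0 < p (Fin.last t)} :
        Set _) → Fin (t + 2) → ℕ)) (r + s) := by
    refine HasSum.add_disjoint (disjoint_snocUp_snocDown _ _) ?_ ?_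
    · rw [← (Equiv.Set.image snocUp (oddStartPaths t) snocUp_injective).hasSum_iff]
      convert hr using 1
      funext p
      simp [snocUp]
    · rw [← (Equiv.Set.image snocDown _ snocDown_injective).hasSum_iff]
      rw [← Function.comp_def (fun p : Fin (t + 1) → ℕ =>
        if 0 < p (Fin.last t) then f (p 0) (p (Fin.last t) - 1) else 0) Subtype.val,
        hasSum_subtype_iff_indicator] at hs
      have h1 := hasSum_subtype_iff_indicator (f := fun p : Fin (t + 1) → ℕ =>
        f (p 0) (p (Fin.last t) - 1)) (s := {p ∈ oddStartPaths t | 0 < p (Fin.last t)}) (a := s)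
      convert h1.2 ?_ using 1
      · funext p
        simp [snocDown]
      · convert hs using 1
        funext p
        by_cases h2 : p ∈ oddStartPaths t <;> by_cases h3 : 0 < p (Fin.last t) <;>
          simp [h2, h3]
  rw [← oddStartPaths_succ] at key
  exact key

variable {M : Type*} [AddCommGroup M] [Module R M]
  {α β : Rˣ} {D E : Module.End R M} {W : M →ₗ[R] R} {V : M}

theorem hasSum_tailWeight {c d u : R} (hu : HasSum (fun n : ℕ => (c * d) ^ n) u) (i m : ℕ) :
    HasSum (fun k : ℕ => c ^ k * tailWeight d (2 * i + 1) m (2 * k + 1)) (c ^ i * d ^ m * u) := by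
  have hinj : Function.Injective fun n : ℕ => n + i := add_left_injective i
  rw [← hinj.hasSum_iff]
  · convert hu.mul_left (c ^ i * d ^ m) using 1
    · rfl
    funext n
    simp only [Function.comp_apply, tailWeight]
    rw [if_pos (by omega), show (2 * (n + i) + 1 - (2 * i + 1)) / 2 = n by omega, mul_pow]
    ring
  · intro k hk
    have : ¬ (2 * i + 1 ≤ 2 * k + 1) := fun h => hk ⟨k - i, by simp; omega⟩
    simp [tailWeight, this]

/-- Paths of length zero with an odd height. -/
def oddStartPathsZero : ℕ ≃ oddStartPaths 0 where
  toFun k := ⟨fun _ => 2 * k + 1, fun j => j.elim0, k, rfl⟩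
  invFun p := p.1 0 / 2
  left_inv k := by simp; omega
  right_inv p := by
    obtain ⟨p, -, k, hk⟩ := p
    refine Subtype.ext (funext fun i => ?_)
    rw [Fin.fin_one_eq_zero i]
    simp only [hk]
    omega

/-- A last step up or down lowers or raises the threshold `j` by one, matching the two terms of
`D_T_pow` or `E_T_pow`. At `j = 0` the step up raises `m` instead, matching `D = 1 + (D - 1)`. At
length zero both sides are `c ^ i d ^ m`, because `κ ^ 2` cancels the geometric series. -/
theorem hasSum_oddStartPaths (h : IsDEHP α β D E W V) {κ c d u : R}
    (hc : c = ((α⁻¹ : Rˣ) : R) - 1) (hd : d = ((β⁻¹ : Rˣ) : R) - 1)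
    (hu : HasSum (fun n : ℕ => (c * d) ^ n) u) (hκ : κ ^ 2 * u = 1) (t : ℕ) :
    ∀ j m, Odd (j + t) → HasSum (fun p : oddStartPaths t =>
      (κ * c ^ (p.1 0 / 2)) * (κ * tailWeight d j m (p.1 (Fin.last t))))
      (W (altProd D E t (((E - 1) ^ (j / 2)) (((D - 1) ^ m) V)))) := by
  induction t with
  | zero =>
    rintro _ m ⟨i, rfl⟩
    rw [altProd, Module.End.one_apply, h.map_T_pow, h.S_pow_apply, map_smul, h.normalised, ← hc,
      ← hd, ← oddStartPathsZero.hasSum_iff]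
    convert (hasSum_tailWeight hu i m).mul_left (κ ^ 2) using 1
    · rfl
    · funext k
      simp only [Function.comp_apply, oddStartPathsZero, Equiv.coe_fn_mk]
      rw [show (2 * k + 1) / 2 = k by omega]
      ring
    · rw [show (2 * i + 1) / 2 = i by omega, smul_eq_mul]
      linear_combination -(c ^ i * d ^ m) * hκ
  | succ t ih =>
    intro j m hj
    -- At height zero the guard is harmless: the weight with threshold `j + 1` vanishes there too.
    have hdown : HasSum (fun p : oddStartPaths t =>
        if 0 < p.1 (Fin.last t) then
          (κ * c ^ (p.1 0 / 2)) * (κ * tailWeight d j m (p.1 (Fin.last t) - 1)) else 0)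
        (W (altProd D E t (((E - 1) ^ ((j + 1) / 2)) (((D - 1) ^ m) V)))) := by
      convert ih (j + 1) m (by rwa [add_right_comm, add_assoc]) using 1
      funext p
      by_cases hx : j + 1 ≤ p.1 (Fin.last t)
      · rw [if_pos (by omega), tailWeight, if_pos (by omega), tailWeight, if_pos hx,
          Nat.sub_sub, add_comm 1 j]
      · rw [tailWeight, tailWeight, if_neg hx]
        by_cases hx' : 0 < p.1 (Fin.last t)
        · rw [if_pos hx', if_neg (by omega)]
        · rw [if_neg hx', mul_zero, mul_zero]
    rcases j with - | j
    · have ht : Even t := by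
        rw [zero_add] at hj
        rwa [Nat.odd_add_one, Nat.not_odd_iff_even] at hj
      have hup : HasSum (fun p : oddStartPaths t =>
          (κ * c ^ (p.1 0 / 2)) * (κ * tailWeight d 0 m (p.1 (Fin.last t) + 1)))
          (W (altProd D E t (((D - 1) ^ (m + 1)) V))) := by
        -- For even `t` the height `x` is odd, so `(x + 1) / 2 + m = (x - 1) / 2 + (m + 1)`.
        have h1 := ih 1 (m + 1) (by rw [add_comm]; exact ht.add_one)
        simp only [show 1 / 2 = 0 from rfl, pow_zero, Module.End.one_apply] at h1
        convert h1 using 1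
        funext p
        obtain ⟨l, hl⟩ := odd_add_last p.2
        obtain ⟨i, hi⟩ := ht
        rw [tailWeight, tailWeight, if_pos (by omega), if_pos (by omega),
          show (p.1 (Fin.last t) + 1 - 0) / 2 + m = (p.1 (Fin.last t) - 1) / 2 + (m + 1) by omega]
      convert hasSum_oddStartPaths_succ
        (f := fun x y => (κ * c ^ (x / 2)) * (κ * tailWeight d 0 m y)) hup hdown using 1
      rw [altProd_succ_of_even _ _ ht, ← map_add, ← map_add, pow_succ', Module.End.mul_apply,
        LinearMap.sub_apply]
      simp
    · obtain ⟨l, hl⟩ := hj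
      have hup : HasSum (fun p : oddStartPaths t =>
          (κ * c ^ (p.1 0 / 2)) * (κ * tailWeight d (j + 1) m (p.1 (Fin.last t) + 1)))
          (W (altProd D E t (((E - 1) ^ (j / 2)) (((D - 1) ^ m) V)))) := by
        convert ih j m ⟨l - 1, by omega⟩ using 1
        funext p
        simp only [tailWeight, Nat.add_le_add_iff_right, Nat.add_sub_add_right]
      convert hasSum_oddStartPaths_succ
        (f := fun x y => (κ * c ^ (x / 2)) * (κ * tailWeight d (j + 1) m y)) hup hdown using 1
      rw [← map_add, ← map_add, show (j + 1 + 1) / 2 = j / 2 + 1 by omega]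
      rcases Nat.even_or_odd t with ht | ht
      · rw [altProd_succ_of_even _ _ ht]
        obtain ⟨i, hi⟩ := ht
        rw [show (j + 1) / 2 = j / 2 + 1 by omega, h.D_T_pow]
      · rw [altProd_succ_of_odd _ _ ht]
        obtain ⟨i, hi⟩ := ht
        rw [show (j + 1) / 2 = j / 2 by omega, IsDEHP.E_T_pow]

theorem R₂_eq_oddStartPaths (L : ℕ) : R₂ L = oddStartPaths (2 * L) := by
  ext p
  refine ⟨fun hp => ⟨hp.1, hp.2.1⟩, fun hp => ⟨hp.1, hp.2, ?_⟩⟩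
  obtain ⟨l, hl⟩ := odd_add_last hp
  exact ⟨l - L, by omega⟩

theorem hasSum_R₂ [T2Space R] (h : IsDEHP α β D E W V) {κ c d : R}
    (hc : c = ((α⁻¹ : Rˣ) : R) - 1) (hd : d = ((β⁻¹ : Rˣ) : R) - 1)
    (hκ : κ ^ 2 = 1 - c * d) (hs : Summable fun n : ℕ => (c * d) ^ n) (L : ℕ) :
    HasSum (fun p : R₂ L => weight₂ κ c d p.val) (normalisation D E W V L) := by
  -- With `j = 1`, `m = 0` the tail weight at `2 k' + 1` is `d ^ k'`, and both operator powers
  -- acting on `V` are trivial.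
  have h1 := hasSum_oddStartPaths h hc hd hs.hasSum (by rw [hκ]; exact hs.one_sub_mul_tsum_pow)
    (2 * L) 1 0 ⟨L, by ring⟩
  rw [altProd_two_mul, ← R₂_eq_oddStartPaths] at h1
  convert h1 using 1
  swap
  · rfl
  funext p
  obtain ⟨k, hk⟩ := p.2.2.2
  rw [weight₂, tailWeight, if_pos (by omega), hk, show (2 * k + 1) / 2 = k by omega,
    show (2 * k + 1 - 1) / 2 + 0 = k by omega]

end RiggedBallotPaths

end ASEP

theorem mainTheorem1
    {R : Type*} [CommRing R] [TopologicalSpace R] [IsTopologicalRing R] [T2Space R]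
    {M : Type*} [AddCommGroup M] [Module R M]
    (α β : Rˣ) (D E : Module.End R M) (W : M →ₗ[R] R) (V : M)
    (h : ASEP.IsDEHP α β D E W V)
    (a b c d : R) (ha : a = ((α⁻¹ : Rˣ) : R)) (hb : b = ((β⁻¹ : Rˣ) : R))
    (hc : c = a - 1) (hd : d = b - 1) (L : ℕ) :
    ((ASEP.R₁ L).Finite ∧
      ASEP.normalisation D E W V L = ∑ᶠ p ∈ ASEP.R₁ L, ASEP.weight₁ a b p) ∧
    (∀ κ : R, κ ^ 2 = a + b - a * b → Summable (fun n : ℕ => (c * d) ^ n) →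
      HasSum (fun p : ASEP.R₂ L => ASEP.weight₂ κ c d p.val)
        (ASEP.normalisation D E W V L)) ∧
    ((ASEP.R₃ L).Finite ∧ ∀ κ : R, κ ^ 2 = a + b - a * b →
      ASEP.normalisation D E W V L = ∑ᶠ p ∈ ASEP.R₃ L, ASEP.weight₃ a b κ p) ∧
    ((ASEP.R₄ L).Finite ∧
      ASEP.normalisation D E W V L = ∑ᶠ q ∈ ASEP.R₄ L, ASEP.weight₄ a b q) := by
  subst ha hb
  refine ⟨⟨ASEP.finite_R₁ L, ASEP.normalisation_eq_sum_R₁ h L⟩, fun κ hκ hs => ?_,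
    ⟨ASEP.finite_R₃ L, fun κ hκ => ASEP.normalisation_eq_sum_R₃ h κ hκ L⟩,
    ASEP.finite_R₄ L, ?_⟩
  · refine ASEP.hasSum_R₂ h hc hd ?_ hs L
    rw [hκ, hc, hd]
    ring
  · rw [ASEP.finsum_R₄, h.normalisation_eq_returnSum]
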